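/- Let $\sigma_1,\dots,\sigma_d\ge 0$ be the singular values of a matrix, let $k\ge 0$ be an integer and put $\beta_l=(\sigma_l^{2k})^2$. Fix an index $i$ such that $\sigma_i>0$ and $\sigma_l>0$ for at least one $l\ne i$, and let $$\alpha_i=\frac12\,\frac{\big(\sum_{l\ne i}\beta_l\big)^2}{\sum_{l\ne i}\beta_l^2},\qquad \gamma_i=\frac1{\beta_i}\,\frac{\sum_{l\ne i}\beta_l^2}{\sum_{l\ne i}\beta_l}.$$ Let $u\sim\mathcal G(\tfrac12,2)$ and $v_i\sim\mathcal G(\alpha_i,2\gamma_i)$ be independent, where $\mathcal G(a,\theta)$ is the Gamma distribution with shape $a$ and scale $\theta$, and let $x_i=\frac{u}{u+v_i}$. Then $x_i$ has the probability density $$x_i^\bullet(z)=\frac{\gamma_i}{(1-(1-\gamma_i)z)^2}\;\mathcal B\Big(\frac{\gamma_i z}{1-(1-\gamma_i)z};\tfrac12,\alpha_i\Big),$$ where $\mathcal B(\,\cdot\,;\tfrac12,\alpha_i)$ is the density of the Beta distribution with parameters $\tfrac12,\alpha_i$ (so $x_i^\bullet$ vanishes outside $[0,1]$). Let ${}_2F_1(a,b;c;x)$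 be, for real $x<1$, the analytic continuation to $(-\infty,1)$ of the Gauss series $\sum_n\frac{(a)_n(b)_n}{(c)_n}\frac{x^n}{n!}$, and, for $x=1$, the sum of that series. The functions $z\,x_i^\bullet(z)$ and $z^2x_i^\bullet(z)$ are integrable on $[0,1]$, and with $\lambda_i=\int_0^1 z\,x_i^\bullet(z)\,\mathrm dz$ the variance $\omega_i^2$ of $x_i$ is $$\omega_i^2=\mathbb E(x_i^2)-(\mathbb E x_i)^2=\int_0^1 z^2x_i^\bullet(z)\,\mathrm dz-\lambda_i^2$$ $$=\frac1{\sqrt\pi}\,\gamma_i^{1/2}\,\frac{\Gamma(\frac12+\alpha_i)}{\Gamma(\alpha_i)}\Big(\tfrac25\;{}_2F_1\big(\tfrac52,1-\alpha_i;\tfrac72;1\big)\;{}_2F_1\big(\tfrac52,\tfrac32+\alpha_i;\tfrac52+\alpha_i;1-\gamma_i\big)$$ $$\qquad+\tfrac27(\gamma_i-1)\;{}_2F_1\big(\tfrac72,1-\alpha_i;\tfrac92;1\big)\;{}_2F_1\big(\tfrac72,\tfrac32+\alpha_i;\tfrac72+\alpha_i;1-\gamma_i\big)\Big)-\lambda_i^2,$$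 where $$\lambda_i=\gamma_i^{1/2}\,\frac{\Gamma(\frac32)\Gamma(\frac12+\alpha_i)}{\Gamma(\frac12)\Gamma(\frac32+\alpha_i)}\;{}_2F_1\big(\tfrac32,\tfrac12+\alpha_i;\tfrac32+\alpha_i;1-\gamma_i\big).$$ To five decimals the three constants are $\frac1{\sqrt\pi}\approx0.56419$, $\frac25=0.4$ and $\frac27\approx0.28571$ (each error is at most $5\cdot10^{-6}$). -/

import Mathlib

open MeasureTheory ProbabilityTheory Set

noncomputable section

/-- `f` is a real-analytic continuation to `(-∞, 1)` of the Gauss hypergeometric series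
`∑ (a)ₙ (b)ₙ / (c)ₙ xⁿ / n!` (Mathlib's `ordinaryHypergeometric`), which converges for `|x| < 1`. -/
def IsGaussContinuation (a b c : ℝ) (f : ℝ → ℝ) : Prop :=
  AnalyticOnNhd ℝ f (Iio 1) ∧ ∀ x : ℝ, |x| < 1 → f x = ordinaryHypergeometric a b c x

open Classical in
/-- The hypergeometric function `₂F₁(a, b; c; x)` for real `x ≤ 1`: on `(-∞, 1)` it is the analytic
continuation of the Gauss series, at `x = 1` it is the sum of the Gauss series. Values at `x > 1`,
on the branch cut, carry no meaning. -/
def hyp2F1 (a b c x : ℝ) : ℝ :=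
  if h : x < 1 ∧ ∃ f : ℝ → ℝ, IsGaussContinuation a b c f then h.2.choose x
  else ordinaryHypergeometric a b c x

/-- The analytic continuation is unique, so `hyp2F1` does not depend on any choice. -/
theorem hyp2F1_eq_of_isGaussContinuation {a b c : ℝ} {f : ℝ → ℝ}
    (hf : IsGaussContinuation a b c f) {x : ℝ} (hx : x < 1) : hyp2F1 a b c x = f x := by
  have h : x < 1 ∧ ∃ f : ℝ → ℝ, IsGaussContinuation a b c f := ⟨hx, f, hf⟩
  have hg := h.2.choose_spec
  rw [hyp2F1, dif_pos h]
  refine hg.1.eqOn_of_preconnected_of_eventuallyEq hf.1 isPreconnected_Iio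
    (show (0 : ℝ) ∈ Iio 1 by simp) ?_ hx
  filter_upwards [Metric.ball_mem_nhds (0 : ℝ) one_pos] with y hy
  have hy' : |y| < 1 := by simpa using hy
  rw [hg.2 y hy', hf.2 y hy']

/-- The Gamma distribution `𝒢(a, θ)` with shape `a` and *scale* `θ`
(Mathlib's `gammaMeasure` takes the rate `θ⁻¹`). -/
def gammaLaw (a θ : ℝ) : Measure ℝ := gammaMeasure a θ⁻¹

/-- `β_l = (σ_l ^ (2k))²`. -/
def specWeight {d : ℕ} (σ : Fin d → ℝ) (k : ℕ) (l : Fin d) : ℝ := (σ l ^ (2 * k)) ^ 2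

/-- `α_i = ½ (∑_{l ≠ i} β_l)² / ∑_{l ≠ i} β_l²`. -/
def specShape {d : ℕ} (σ : Fin d → ℝ) (k : ℕ) (i : Fin d) : ℝ :=
  1 / 2 * ((∑ l ∈ Finset.univ.erase i, specWeight σ k l) ^ 2
    / ∑ l ∈ Finset.univ.erase i, specWeight σ k l ^ 2)

/-- `γ_i = (1 / β_i) (∑_{l ≠ i} β_l²) / ∑_{l ≠ i} β_l`. -/
def specScale {d : ℕ} (σ : Fin d → ℝ) (k : ℕ) (i : Fin d) : ℝ :=
  1 / specWeight σ k i * ((∑ l ∈ Finset.univ.erase i, specWeight σ k l ^ 2)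
    / ∑ l ∈ Finset.univ.erase i, specWeight σ k l)

/-- The density `x•(z) = γ / (1 - (1 - γ) z)² · ℬ(γ z / (1 - (1 - γ) z); ½, α)`, where `ℬ(·; ½, α)`
is the Beta density. -/
def specDensity (α γ z : ℝ) : ℝ :=
  γ / (1 - (1 - γ) * z) ^ 2 * betaPDFReal (1 / 2) α (γ * z / (1 - (1 - γ) * z))

/-- `λ = ∫₀¹ z x•(z) dz`. -/
def specMean (α γ : ℝ) : ℝ := ∫ z in (0 : ℝ)..1, z * specDensity α γ z

end

/-! Put D(z) = 1 - (1 - γ)z. On (0,1) the density equals γ^{1/2}/B(1/2, α) · z^{-1/2} (1 - z)^{α-1}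
D(z)^{-(1/2+α)} (`specDensity_of_mem`). It arises from the joint Gamma density by substituting v =
u(1 - z)/z and integrating out u, which is a Gamma integral (`lintegral_gammaPDF_mul_gammaPDF`,
`hasLaw_div_add_gammaLaw`).

Every moment is therefore an Euler integral at the argument 1 - γ < 1, equal to a Beta value times a
₂F₁ (`integral_eq_beta_mul_hyp2F1`). As γ may exceed 2, the argument can leave the unit disc, so the
integral is shown to be analytic on all of (-∞, 1) and is thus the continuation of the Gauss series.

The mean is read off directly. For the second moment, D^{-(1/2+α)} = D^{-(3/2+α)} (1 + (γ - 1)z)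
splits the integral into two Euler integrals with prefactors B(5/2, α) and B(7/2, α). Expanding (1 -
t)^{α-1} gives B(s, α) = s⁻¹ ₂F₁(s, 1 - α; s + 1; 1) (`hyp2F1_at_one`), whence the coefficients 2/5
and 2/7. -/

open scoped Nat

/-! ### Binomial series and Beta integrals. -/

/-- The binomial series of `(1 - y) ^ (-q)` in terms of rising factorials. -/
theorem hasSum_one_sub_rpow_neg (q : ℝ) {y : ℝ} (hy : |y| < 1) :
    HasSum (fun n : ℕ => (n ! : ℝ)⁻¹ * (ascPochhammer ℝ n).eval q * y ^ n) ((1 - y) ^ (-q)) := by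
  have h := (Real.one_div_one_sub_rpow_hasFPowerSeriesOnBall_zero q).hasSum
    (y := y) (by simpa [Metric.mem_eball, edist_dist, Real.dist_eq, ENNReal.ofReal_lt_one] using hy)
  have h1 : (1 - y) ^ (-q) = 1 / (1 - (0 + y)) ^ q := by
    rw [zero_add, Real.rpow_neg (by linarith [(abs_lt.1 hy).2]), one_div]
  rw [h1]
  refine h.congr_fun fun n => ?_
  have h2 : Ring.choose (q + n - 1) n = (n ! : ℝ)⁻¹ * (ascPochhammer ℝ n).eval q := by
    have := Ring.factorial_nsmul_multichoose_eq_ascPochhammer q n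
    rw [Polynomial.ascPochhammer_smeval_eq_eval, nsmul_eq_mul] at this
    rw [← this, inv_mul_cancel_left₀ (by exact_mod_cast n.factorial_ne_zero)]
    change Ring.multichoose (q + n - 1 - n + 1) n = _
    congr 1
    ring
  simp [h2, mul_comm]

/-- Termwise integration of the binomial series of `(1 - x t) ^ (-q)` against a weight. -/
theorem hasSum_integral_mul_one_sub_rpow {w : ℝ → ℝ} {q x : ℝ} (hq : 0 ≤ q) (hx : |x| ≤ 1)
    (hw0 : ∀ t ∈ Ioo (0 : ℝ) 1, 0 ≤ w t) (hw : Measurable w)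
    (hint : IntegrableOn (fun t => w t * (1 - |x| * t) ^ (-q)) (Ioo 0 1)) :
    HasSum (fun n : ℕ => (n ! : ℝ)⁻¹ * (ascPochhammer ℝ n).eval q * x ^ n *
      ∫ t in Ioo (0 : ℝ) 1, w t * t ^ n) (∫ t in Ioo (0 : ℝ) 1, w t * (1 - x * t) ^ (-q)) := by
  have hc : ∀ n : ℕ, 0 ≤ (n ! : ℝ)⁻¹ * (ascPochhammer ℝ n).eval q := fun n => by
    rcases hq.eq_or_lt with rfl | hq
    · rw [ascPochhammer_eval_zero]; positivity
    · have := ascPochhammer_pos n q hq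
      positivity
  have hlt : ∀ y : ℝ, |y| ≤ 1 → ∀ t ∈ Ioo (0 : ℝ) 1, |y * t| < 1 := fun y hy t ht => by
    rw [abs_mul, abs_of_pos ht.1]
    nlinarith [ht.1, ht.2, abs_nonneg y]
  have hsum : ∀ y : ℝ, |y| ≤ 1 → ∀ t ∈ Ioo (0 : ℝ) 1,
      HasSum (fun n : ℕ => (n ! : ℝ)⁻¹ * (ascPochhammer ℝ n).eval q * y ^ n * (w t * t ^ n))
        (w t * (1 - y * t) ^ (-q)) := fun y hy t ht => by
    refine ((hasSum_one_sub_rpow_neg q (hlt y hy t ht)).mul_left (w t)).congr_fun fun n => ?_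
    rw [mul_pow]; ring
  have hax : |(|x|)| ≤ 1 := by rwa [abs_abs]
  -- As (q)ₙ ≥ 0 and w ≥ 0, the absolute values of the terms form the same series at |x|. Its sum is
  -- integrable by `hint`, which also covers |x| = 1.
  have key := hasSum_integral_of_dominated_convergence (μ := volume.restrict (Ioo (0 : ℝ) 1))
    (F := fun (n : ℕ) t =>
      (n ! : ℝ)⁻¹ * (ascPochhammer ℝ n).eval q * x ^ n * (w t * t ^ n))
    (f := fun t => w t * (1 - x * t) ^ (-q))
    (fun (n : ℕ) t => (n ! : ℝ)⁻¹ * (ascPochhammer ℝ n).eval q * |x| ^ n * (w t * t ^ n))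
    (fun n => by fun_prop) ?_ ?_ ?_ ?_
  · simpa only [integral_const_mul] using key
  · refine fun n => ae_restrict_of_forall_mem measurableSet_Ioo fun t ht => le_of_eq ?_
    rw [Real.norm_eq_abs, abs_mul, abs_mul, abs_of_nonneg (hc n), abs_pow,
      abs_of_nonneg (mul_nonneg (hw0 t ht) (pow_nonneg ht.1.le n))]
  · exact ae_restrict_of_forall_mem measurableSet_Ioo fun t ht => (hsum _ hax t ht).summable
  · exact hint.congr_fun (fun t ht => (hsum _ hax t ht).tsum_eq.symm) measurableSet_Ioo
  · exact ae_restrict_of_forall_mem measurableSet_Ioo fun t ht => hsum _ hx t ht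

theorem integrableOn_rpow_mul_one_sub_rpow {p α : ℝ} (hp : 0 < p) (hα : 0 < α) :
    IntegrableOn (fun t : ℝ => t ^ (p - 1) * (1 - t) ^ (α - 1)) (Ioo 0 1) := by
  have h := Complex.betaIntegral_convergent (u := p) (v := α) (by simpa) (by simpa)
  rw [intervalIntegrable_iff_integrableOn_Ioo_of_le zero_le_one] at h
  refine (Integrable.re h).congr (ae_restrict_of_forall_mem measurableSet_Ioo fun t ht => ?_)
  have h1 := Complex.ofReal_cpow ht.1.le (p - 1)
  have h2 := Complex.ofReal_cpow (sub_nonneg.2 ht.2.le) (α - 1)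
  push_cast at h1 h2
  simp only [← h1, ← h2, ← Complex.ofReal_mul, RCLike.re_to_complex, Complex.ofReal_re]

theorem integral_rpow_mul_one_sub_rpow {p α : ℝ} (hp : 0 < p) (hα : 0 < α) :
    ∫ t in Ioo (0 : ℝ) 1, t ^ (p - 1) * (1 - t) ^ (α - 1) = beta p α := by
  rw [beta_eq_betaIntegralReal p α hp hα, Complex.betaIntegral,
    intervalIntegral.integral_of_le zero_le_one, integral_Ioc_eq_integral_Ioo,
    ← RCLike.re_to_complex, ← integral_re]
  · refine setIntegral_congr_fun measurableSet_Ioo fun t ht => ?_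
    have h1 := Complex.ofReal_cpow ht.1.le (p - 1)
    have h2 := Complex.ofReal_cpow (sub_nonneg.2 ht.2.le) (α - 1)
    push_cast at h1 h2
    simp only [← h1, ← h2, ← Complex.ofReal_mul, RCLike.re_to_complex, Complex.ofReal_re]
  · have h := Complex.betaIntegral_convergent (u := p) (v := α) (by simpa) (by simpa)
    rwa [intervalIntegrable_iff_integrableOn_Ioo_of_le zero_le_one] at h

theorem beta_add_one_left {p α : ℝ} (hp : 0 < p) (hα : 0 < α) :
    beta (p + 1) α = beta p α * (p / (p + α)) := by
  rw [beta, beta, add_right_comm, Real.Gamma_add_one hp.ne', Real.Gamma_add_one (by positivity)]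
  have := (Real.Gamma_pos_of_pos (add_pos hp hα)).ne'
  field_simp

/-- Under the integral sign this is (1 - t)^α = (1 - t)^{α-1} (1 - t). It lowers α by one in the
induction of `hasSum_beta`. -/
theorem beta_add_one_right {p α : ℝ} (hp : 0 < p) (hα : 0 < α) :
    beta p (α + 1) = beta p α - beta (p + 1) α := by
  rw [beta_add_one_left hp hα, beta, beta, ← add_assoc, Real.Gamma_add_one hα.ne',
    Real.Gamma_add_one (by positivity)]
  have := (Real.Gamma_pos_of_pos (add_pos hp hα)).ne'
  field_simp
  ring

theorem beta_add_nat_left {p α : ℝ} (hp : 0 < p) (hα : 0 < α) (n : ℕ) :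
    beta (p + n) α =
      beta p α * ((ascPochhammer ℝ n).eval p * ((ascPochhammer ℝ n).eval (p + α))⁻¹) := by
  induction n with
  | zero => simp
  | succ n ih =>
    have h := (ascPochhammer_pos n (p + α) (by positivity)).ne'
    rw [Nat.cast_succ, ← add_assoc, beta_add_one_left (by positivity) hα, ih,
      ascPochhammer_succ_eval, ascPochhammer_succ_eval]
    have : p + α + n ≠ 0 := by positivity
    have : p + n + α ≠ 0 := by positivity
    field_simp
    ring

/-! ### Euler's integral as the continuation of the Gauss series. -/

/-- Analyticity on `(-∞, 1)` of Euler's integral `∫ w(t) (1 - x t) ^ (-q) dt`. -/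
theorem analyticOnNhd_integral_mul_one_sub_rpow {w : ℝ → ℝ} {q : ℝ} (hq : 0 ≤ q)
    (hw : Measurable w) (hint : IntegrableOn w (Ioo 0 1)) :
    AnalyticOnNhd ℝ (fun x => ∫ t in Ioo (0 : ℝ) 1, w t * (1 - x * t) ^ (-q)) (Iio 1) := by
  set U : Set ℂ := {z | z.re < 1} with hU
  have hUo : IsOpen U := isOpen_lt Complex.continuous_re continuous_const
  -- For Re z < 1 and 0 < t < 1 the base 1 - zt has positive real part, so the power stays off its
  -- branch cut. Complex differentiability on an open set then yields analyticity.
  have hdiff : DifferentiableOn ℂ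
      (fun z : ℂ => ∫ t in Ioo (0 : ℝ) 1, (w t : ℂ) * (1 - z * t) ^ ((-q : ℝ) : ℂ)) U := by
    intro z₀ hz₀
    obtain ⟨r, hr, hr1⟩ := exists_between (show z₀.re < 1 from hz₀)
    -- Lower bound for Re(1 - zt) uniform in t and in Re z < r: it is 1 when Re z ≤ 0 and 1 - r
    -- otherwise.
    set m : ℝ := min 1 (1 - r) with hm
    have hm0 : 0 < m := lt_min one_pos (by linarith)
    have hre : ∀ z : ℂ, z.re < r → ∀ t ∈ Ioo (0 : ℝ) 1, m ≤ (1 - z * t).re := fun z hz t ht => by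
      have h1 : (1 - z * t).re = 1 - z.re * t := by simp
      rw [h1]
      rcases le_total z.re 0 with h | h
      · exact (min_le_left _ _).trans (by nlinarith [ht.1])
      · exact (min_le_right _ _).trans (by nlinarith [ht.2])
    have hnorm : ∀ s : ℝ, 0 ≤ s → ∀ z : ℂ, z.re < r → ∀ t ∈ Ioo (0 : ℝ) 1,
        ‖(1 - z * t) ^ ((-s : ℝ) : ℂ)‖ ≤ m ^ (-s) := fun s hs z hz t ht => by
      rw [Complex.norm_cpow_real]
      exact Real.rpow_le_rpow_of_nonpos hm0
        ((hre z hz t ht).trans ((le_abs_self _).trans (Complex.abs_re_le_norm _))) (by linarith)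
    have hmeas : ∀ s : ℝ, ∀ z : ℂ, Measurable fun t : ℝ =>
        (1 - z * t) ^ ((-s : ℝ) : ℂ) := fun s z => by fun_prop
    have hwc : IntegrableOn (fun t => (w t : ℂ)) (Ioo 0 1) := hint.ofReal
    have key := hasDerivAt_integral_of_dominated_loc_of_deriv_le
      (μ := volume.restrict (Ioo (0 : ℝ) 1)) (x₀ := z₀) (s := {z : ℂ | z.re < r})
      (F := fun z t => (w t : ℂ) * (1 - z * t) ^ ((-q : ℝ) : ℂ))
      (F' := fun z t => (w t : ℂ) * (((-q : ℝ) : ℂ) * (1 - z * t) ^ ((-(q + 1) : ℝ) : ℂ) * (-t)))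
      (bound := fun t => |w t| * (q * m ^ (-(q + 1))))
      ((isOpen_lt Complex.continuous_re continuous_const).mem_nhds hr)
      (Filter.Eventually.of_forall fun z => by fun_prop) ?_ (by fun_prop) ?_
      (hint.abs.mul_const _) ?_
    · exact key.2.differentiableAt.differentiableWithinAt
    · refine Integrable.mul_bdd (c := m ^ (-q)) hwc (hmeas q z₀).aestronglyMeasurable
        (ae_restrict_of_forall_mem measurableSet_Ioo fun t ht => hnorm q hq z₀ hr t ht)
    · refine ae_restrict_of_forall_mem measurableSet_Ioo fun t ht z hz => ?_
      rw [norm_mul, norm_mul, norm_mul, norm_neg, Complex.norm_real, Complex.norm_real,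
        Complex.norm_real, Real.norm_eq_abs, Real.norm_eq_abs, Real.norm_eq_abs, abs_neg,
        abs_of_nonneg hq, abs_of_pos ht.1]
      have h1 := hnorm (q + 1) (by linarith) z hz t ht
      refine mul_le_mul_of_nonneg_left ?_ (abs_nonneg _)
      calc q * ‖(1 - z * t) ^ ((-(q + 1) : ℝ) : ℂ)‖ * t
          ≤ q * m ^ (-(q + 1)) * 1 := by
            have := ht.2.le
            have := ht.1.le
            gcongr
        _ = _ := mul_one _
    · refine ae_restrict_of_forall_mem measurableSet_Ioo fun t ht z hz => ?_
      have hd : HasDerivAt (fun z : ℂ => 1 - z * t) (-t) z := by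
        simpa using ((hasDerivAt_id z).mul_const (t : ℂ)).const_sub 1
      have hs : 1 - z * t ∈ Complex.slitPlane :=
        Or.inl (hm0.trans_le (hre z hz t ht))
      have := (hd.cpow_const (c := ((-q : ℝ) : ℂ)) hs).const_mul (w t : ℂ)
      have he : ((-(q + 1) : ℝ) : ℂ) = ((-q : ℝ) : ℂ) - 1 := by push_cast; ring
      simpa only [he] using this
  intro x hx
  have hx1 : x < 1 := hx
  have han := (hdiff.analyticAt (z := (x : ℂ)) (hUo.mem_nhds (by simpa [hU] using hx1))).re_ofReal
  refine han.congr ?_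
  filter_upwards [Iio_mem_nhds hx1] with y hy
  have hy1 : y < 1 := hy
  have : ∫ t in Ioo (0 : ℝ) 1, (w t : ℂ) * (1 - (y : ℂ) * t) ^ ((-q : ℝ) : ℂ) =
      ∫ t in Ioo (0 : ℝ) 1, ((w t * (1 - y * t) ^ (-q) : ℝ) : ℂ) := by
    refine setIntegral_congr_fun measurableSet_Ioo fun t ht => ?_
    have h0 : 0 ≤ 1 - y * t := by nlinarith [ht.1, ht.2]
    simp only [Complex.ofReal_mul, Complex.ofReal_cpow h0]
    push_cast
    rfl
  rw [this, integral_complex_ofReal, Complex.ofReal_re]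

/-- For x < 1 the factor 1 - xt does not vanish on the compact [0,1], so its power is bounded there,
whatever the sign of the exponent. -/
theorem integrableOn_rpow_mul_one_sub_rpow_mul {p α x : ℝ} (hp : 0 < p) (hα : 0 < α) (q : ℝ)
    (hx : x < 1) :
    IntegrableOn (fun t : ℝ => t ^ (p - 1) * (1 - t) ^ (α - 1) * (1 - x * t) ^ (-q))
      (Ioo 0 1) := by
  have hcont : ContinuousOn (fun t : ℝ => (1 - x * t) ^ (-q)) (Icc 0 1) := by
    refine ContinuousOn.rpow_const (by fun_prop) fun t ht => Or.inl ?_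
    rcases le_total x 0 with h | h <;> nlinarith [ht.1, ht.2]
  obtain ⟨C, hC⟩ := isCompact_Icc.exists_bound_of_continuousOn hcont
  refine Integrable.mul_bdd (c := C) (integrableOn_rpow_mul_one_sub_rpow hp hα)
    (Measurable.aestronglyMeasurable (by fun_prop)) (ae_restrict_of_forall_mem measurableSet_Ioo fun t ht =>
      hC t (Ioo_subset_Icc_self ht))

/-- Euler's integral for the hypergeometric function on `(-∞, 1)`. -/
theorem integral_eq_beta_mul_hyp2F1 {p α q x : ℝ} (hp : 0 < p) (hα : 0 < α) (hq : 0 ≤ q)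
    (hx : x < 1) :
    ∫ t in Ioo (0 : ℝ) 1, t ^ (p - 1) * (1 - t) ^ (α - 1) * (1 - x * t) ^ (-q) =
      beta p α * hyp2F1 p q (p + α) x := by
  have hb := (beta_pos hp hα).ne'
  have hF : IsGaussContinuation p q (p + α) (fun y => (beta p α)⁻¹ *
      ∫ t in Ioo (0 : ℝ) 1, t ^ (p - 1) * (1 - t) ^ (α - 1) * (1 - y * t) ^ (-q)) := by
    refine ⟨analyticOnNhd_const.mul (analyticOnNhd_integral_mul_one_sub_rpow hq (by fun_prop)
      (integrableOn_rpow_mul_one_sub_rpow hp hα)), fun y hy => ?_⟩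
    have hs := hasSum_integral_mul_one_sub_rpow
      (w := fun t => t ^ (p - 1) * (1 - t) ^ (α - 1)) hq hy.le
      (fun t ht => mul_nonneg (Real.rpow_nonneg ht.1.le _)
        (Real.rpow_nonneg (sub_nonneg.2 ht.2.le) _)) (by fun_prop)
      (integrableOn_rpow_mul_one_sub_rpow_mul hp hα q hy)
    rw [ordinaryHypergeometric_eq_tsum]
    refine ((hs.mul_left (beta p α)⁻¹).congr_fun fun n => ?_).tsum_eq.symm
    have hn : ∫ t in Ioo (0 : ℝ) 1, t ^ (p - 1) * (1 - t) ^ (α - 1) * t ^ n =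
        beta (p + n) α := by
      rw [← integral_rpow_mul_one_sub_rpow (by positivity) hα]
      refine setIntegral_congr_fun measurableSet_Ioo fun t ht => ?_
      rw [show p + n - 1 = p - 1 + n by ring, Real.rpow_add_natCast ht.1.ne']
      ring
    rw [hn, beta_add_nat_left hp hα, smul_eq_mul]
    field_simp
  rw [hyp2F1_eq_of_isGaussContinuation hF hx, mul_inv_cancel_left₀ hb]

/-! ### The value of ₂F₁ at 1. -/

/-- The beta function as a series, convergent for all positive `α`. -/
theorem hasSum_beta {s α : ℝ} (hs : 0 < s) (hα : 0 < α) :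
    HasSum (fun n : ℕ => (n ! : ℝ)⁻¹ * (ascPochhammer ℝ n).eval (1 - α) * (s + n)⁻¹)
      (beta s α) := by
  -- For α ≤ 1 the exponent 1 - α is nonnegative and termwise integration at x = 1 applies. For
  -- larger α the coefficients may be negative, so α is lowered by steps of one.
  obtain ⟨N, hN⟩ := exists_nat_ge α
  induction N generalizing s α with
  | zero => exact absurd hN (by simpa using hα)
  | succ N ih =>
    rcases le_or_gt α 1 with h1 | h1
    · have hcongr : ∀ t ∈ Ioo (0 : ℝ) 1, t ^ (s - 1) * (1 - t) ^ (α - 1) =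
          t ^ (s - 1) * (1 - 1 * t) ^ (-(1 - α)) := fun t _ => by simp
      have hsum := hasSum_integral_mul_one_sub_rpow (w := fun t => t ^ (s - 1)) (q := 1 - α)
        (x := 1) (by linarith) (by simp) (fun t ht => Real.rpow_nonneg ht.1.le _) (by fun_prop)
        (by
          rw [abs_one]
          exact (integrableOn_rpow_mul_one_sub_rpow hs hα).congr_fun hcongr measurableSet_Ioo)
      rw [← setIntegral_congr_fun measurableSet_Ioo hcongr,
        integral_rpow_mul_one_sub_rpow hs hα] at hsum
      refine hsum.congr_fun fun n => ?_
      have hn : ∫ t in Ioo (0 : ℝ) 1, t ^ (s - 1) * t ^ n = (s + n)⁻¹ := by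
        have : ∫ t in Ioo (0 : ℝ) 1, t ^ (s - 1) * t ^ n =
            ∫ t in (0 : ℝ)..1, t ^ (s + n - 1) := by
          rw [intervalIntegral.integral_of_le zero_le_one, integral_Ioc_eq_integral_Ioo]
          refine setIntegral_congr_fun measurableSet_Ioo fun t ht => ?_
          rw [show s + n - 1 = s - 1 + n by ring, Real.rpow_add_natCast ht.1.ne']
        have hpos : 0 < s + n := by positivity
        rw [this, integral_rpow (Or.inl (by linarith))]
        simp [hpos.ne']
      rw [hn]; simp
    · obtain ⟨β, rfl⟩ : ∃ β, α = β + 1 := ⟨α - 1, by ring⟩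
      have hβ : 0 < β := by linarith
      have hβN : β ≤ N := by push_cast at hN; linarith
      have hA := ih hs hβ hβN
      have hB := ih (s := s + 1) (by positivity) hβ hβN
      -- The series for s + 1 is shifted by one index so that both have denominators s + n.
      -- Subtraction then uses (-β)ₙ₊₁/(n+1)! = (1-β)ₙ₊₁/(n+1)! - (1-β)ₙ/n!.
      have hB' : HasSum (fun n : ℕ => if n = 0 then 0 else
          (((n - 1)! : ℕ) : ℝ)⁻¹ * (ascPochhammer ℝ (n - 1)).eval (1 - β) * (s + n)⁻¹)
          (beta (s + 1) β) := by
        rw [← hasSum_nat_add_iff' 1]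
        simp only [Finset.range_one, Finset.sum_singleton, if_true, sub_zero]
        refine hB.congr_fun fun n => ?_
        simp [add_assoc, add_comm (1 : ℝ)]
      rw [beta_add_one_right hs hβ]
      refine (hA.sub hB').congr_fun fun n => ?_
      rcases n with _ | n
      · simp
      · have h2 : (ascPochhammer ℝ (n + 1)).eval (1 - (β + 1)) =
            -β * (ascPochhammer ℝ n).eval (1 - β) := by
          rw [ascPochhammer_succ_left, Polynomial.eval_mul, Polynomial.eval_comp]
          simp [add_comm, sub_eq_add_neg]
        rw [h2, ascPochhammer_succ_eval, Nat.factorial_succ]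
        have : (n ! : ℝ) ≠ 0 := by exact_mod_cast n.factorial_ne_zero
        have : s + ((n : ℝ) + 1) ≠ 0 := by positivity
        simp only [Nat.succ_ne_zero, if_false, Nat.add_sub_cancel]
        push_cast
        field_simp
        ring

/-- Since (s)ₙ/(s+1)ₙ = s/(s + n), the Gauss series at 1 is s times the series of `hasSum_beta`. -/
theorem hyp2F1_at_one {s α : ℝ} (hs : 0 < s) (hα : 0 < α) :
    1 / s * hyp2F1 s (1 - α) (s + 1) 1 = beta s α := by
  have hh : hyp2F1 s (1 - α) (s + 1) 1 = s * beta s α := by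
    rw [hyp2F1, dif_neg (by simp), ordinaryHypergeometric_eq_tsum]
    refine (((hasSum_beta hs hα).mul_left s).congr_fun fun n => ?_).tsum_eq
    have hsn : (ascPochhammer ℝ n).eval s * ((ascPochhammer ℝ n).eval (s + 1))⁻¹ =
        s * (s + n)⁻¹ := by
      have h1 := ascPochhammer_succ_eval n s
      rw [ascPochhammer_succ_left, Polynomial.eval_mul, Polynomial.eval_comp] at h1
      simp only [Polynomial.eval_X, Polynomial.eval_add, Polynomial.eval_one] at h1
      have := (ascPochhammer_pos n (s + 1) (by positivity)).ne'
      have : s + n ≠ 0 := by positivity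
      field_simp
      linarith
    rw [one_pow, smul_eq_mul, mul_one]
    linear_combination ((n ! : ℝ)⁻¹ * (ascPochhammer ℝ n).eval (1 - α)) * hsn
  rw [hh]
  field_simp

/-! ### The density in product form and its support. -/

/-- With D = 1 - (1 - γ)z one has 1 - γz/D = (1 - z)/D. The powers of D collect to -2 + 1/2 - (α -
1) = -(1/2 + α). -/
theorem specDensity_of_mem {α γ z : ℝ} (hγ : 0 < γ) (hz : z ∈ Ioo (0 : ℝ) 1) :
    specDensity α γ z = γ ^ (1 / 2 : ℝ) / beta (1 / 2) α *
      (z ^ (1 / 2 - 1 : ℝ) * (1 - z) ^ (α - 1) * (1 - (1 - γ) * z) ^ (-(1 / 2 + α))) := by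
  obtain ⟨h0, h1⟩ := hz
  have h1' : 0 < 1 - z := sub_pos.2 h1
  have hD : 0 < 1 - (1 - γ) * z := by nlinarith [mul_pos hγ h0]
  set D := 1 - (1 - γ) * z with hDdef
  have hw : 1 - γ * z / D = (1 - z) / D := by
    rw [eq_div_iff hD.ne', sub_mul, div_mul_cancel₀ _ hD.ne', hDdef]; ring
  have hpos : 0 < 1 - γ * z / D := by rw [hw]; positivity
  rw [specDensity, ← hDdef, betaPDFReal, if_pos ⟨by positivity, by linarith⟩, hw,
    Real.div_rpow (by positivity) hD.le, Real.div_rpow h1'.le hD.le,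
    Real.mul_rpow hγ.le h0.le, Real.rpow_sub hγ, Real.rpow_one, Real.rpow_neg hD.le,
    Real.rpow_add hD, Real.rpow_sub hD, Real.rpow_sub hD, Real.rpow_one]
  have := (Real.rpow_pos_of_pos hD α).ne'
  have := (Real.rpow_pos_of_pos hD (1 / 2)).ne'
  field_simp

theorem specDensity_of_notMem {α γ z : ℝ} (hγ : 0 < γ) (hz : z ∉ Ioo (0 : ℝ) 1) :
    specDensity α γ z = 0 := by
  rw [specDensity, betaPDFReal, if_neg, mul_zero]
  rintro ⟨h0, h1⟩
  apply hz
  -- D can vanish or be negative outside [0,1]. If D < 0, the two Beta bounds force z < 0 and z > 1.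
  -- If D = 0, division by zero makes the argument 0, which the strict bound 0 < γz/D excludes.
  rcases lt_trichotomy (1 - (1 - γ) * z) 0 with hD | hD | hD
  · rw [div_lt_one_of_neg hD] at h1
    have h2 := (div_pos_iff.1 h0).resolve_left fun h => absurd h.2 hD.not_gt
    have : z < 0 := by by_contra! h; linarith [mul_nonneg hγ.le h]
    linarith
  · simp [hD] at h0
  · rw [div_lt_one hD] at h1
    rw [div_pos_iff_of_pos_right hD] at h0
    exact ⟨pos_of_mul_pos_right h0 hγ.le, by linarith⟩

theorem specDensity_nonneg {α γ : ℝ} (hα : 0 < α) (hγ : 0 < γ) (z : ℝ) :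
    0 ≤ specDensity α γ z := by
  by_cases hz : z ∈ Ioo (0 : ℝ) 1
  · rw [specDensity_of_mem hγ hz]
    have := beta_pos one_half_pos hα
    have h0 := hz.1
    have h1 : 0 < 1 - z := sub_pos.2 hz.2
    have : 0 < 1 - (1 - γ) * z := by nlinarith [mul_pos hγ h0]
    positivity
  · rw [specDensity_of_notMem hγ hz]

theorem measurable_specDensity (α γ : ℝ) : Measurable (specDensity α γ) := by
  unfold specDensity
  fun_prop

/-! ### The law of u/(u + v). -/

/-- Integrating out the common scale: the marginal density of `u / (u + v)` at `z`. -/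
theorem lintegral_gammaPDF_mul_gammaPDF {α γ z : ℝ} (hα : 0 < α) (hγ : 0 < γ)
    (hz : z ∈ Ioo (0 : ℝ) 1) :
    ∫⁻ u in Ioi (0 : ℝ), gammaPDF (1 / 2) 2⁻¹ u *
      (ENNReal.ofReal (u / z ^ 2) * gammaPDF α (2 * γ)⁻¹ (u * (1 - z) / z)) =
      ENNReal.ofReal (specDensity α γ z) := by
  have h0 := hz.1
  have h1 : 0 < 1 - z := sub_pos.2 hz.2
  have hD : 0 < 1 - (1 - γ) * z := by nlinarith [mul_pos hγ h0]
  -- The combined exponential rate in u, namely 1/2 + (1 - z)/(2γz). Below, `K` gathers all factors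
  -- free of u.
  set r := (1 - (1 - γ) * z) / (2 * γ * z) with hr
  have hr0 : 0 < r := by positivity
  set K := (2⁻¹ : ℝ) ^ (1 / 2 : ℝ) / Real.Gamma (1 / 2) * ((2 * γ)⁻¹ ^ α / Real.Gamma α) *
    ((1 - z) / z) ^ (α - 1) / z ^ 2 with hK
  have hG1 := Real.Gamma_pos_of_pos one_half_pos
  have hG2 := Real.Gamma_pos_of_pos hα
  have hG3 := Real.Gamma_pos_of_pos (add_pos one_half_pos hα)
  have hK0 : 0 < K := by positivity
  have hint : ∫ u in Ioi (0 : ℝ), u ^ (1 / 2 + α - 1) * Real.exp (-(r * u)) =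
      (1 / r) ^ (1 / 2 + α) * Real.Gamma (1 / 2 + α) :=
    Real.integral_rpow_mul_exp_neg_mul_Ioi (by positivity) hr0
  have hconst : K * ((1 / r) ^ (1 / 2 + α) * Real.Gamma (1 / 2 + α)) = specDensity α γ z := by
    have hb := beta_pos one_half_pos hα
    rw [specDensity_of_mem hγ hz]
    -- Both sides are positive products of powers, so taking logarithms turns the identity into a
    -- polynomial one.
    refine Real.log_injOn_pos (mem_Ioi.2 (by positivity)) (mem_Ioi.2 (by positivity)) ?_
    have l1 : Real.log (beta (1 / 2) α) = Real.log (Real.Gamma (1 / 2)) +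
        Real.log (Real.Gamma α) - Real.log (Real.Gamma (1 / 2 + α)) := by
      rw [beta, Real.log_div (by positivity) hG3.ne', Real.log_mul hG1.ne' hG2.ne']
    have l2 : Real.log r = Real.log (1 - (1 - γ) * z) -
        (Real.log 2 + Real.log γ + Real.log z) := by
      rw [hr, Real.log_div hD.ne' (by positivity), Real.log_mul (by positivity) h0.ne',
        Real.log_mul two_ne_zero hγ.ne']
    have l3 : Real.log K = (1 / 2) * (-Real.log 2) - Real.log (Real.Gamma (1 / 2)) +
        (α * (-(Real.log 2 + Real.log γ)) - Real.log (Real.Gamma α)) +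
        (α - 1) * (Real.log (1 - z) - Real.log z) - 2 * Real.log z := by
      rw [hK, Real.log_div (by positivity) (by positivity),
        Real.log_mul (by positivity) (by positivity),
        Real.log_mul (by positivity) (by positivity), Real.log_div (by positivity) hG1.ne',
        Real.log_div (by positivity) hG2.ne', Real.log_rpow (by positivity),
        Real.log_rpow (by positivity), Real.log_rpow (by positivity), Real.log_inv, Real.log_inv,
        Real.log_mul two_ne_zero hγ.ne', Real.log_div h1.ne' h0.ne', Real.log_pow]
      norm_num
    rw [Real.log_mul hK0.ne' (by positivity), Real.log_mul (by positivity) hG3.ne',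
      Real.log_rpow (by positivity), one_div r, Real.log_inv,
      Real.log_mul (by positivity) (by positivity), Real.log_div (by positivity) hb.ne',
      Real.log_rpow hγ, Real.log_mul (by positivity) (by positivity),
      Real.log_mul (by positivity) (by positivity), Real.log_rpow h0, Real.log_rpow h1,
      Real.log_rpow hD, l1, l2, l3]
    ring
  have hintegrand : ∀ u ∈ Ioi (0 : ℝ), gammaPDF (1 / 2) 2⁻¹ u *
      (ENNReal.ofReal (u / z ^ 2) * gammaPDF α (2 * γ)⁻¹ (u * (1 - z) / z)) =
      ENNReal.ofReal (K * (u ^ (1 / 2 + α - 1) * Real.exp (-(r * u)))) := fun u hu => by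
    have hu : 0 < u := hu
    rw [gammaPDF_of_nonneg hu.le, gammaPDF_of_nonneg (by positivity),
      ← ENNReal.ofReal_mul (by positivity), ← ENNReal.ofReal_mul (by positivity)]
    congr 1
    have he : Real.exp (-(r * u)) = Real.exp (-(2⁻¹ * u)) *
        Real.exp (-((2 * γ)⁻¹ * (u * (1 - z) / z))) := by
      rw [← Real.exp_add, hr]
      congr 1
      field_simp
      ring
    have hp : u ^ (1 / 2 + α - 1) = u ^ (1 / 2 - 1 : ℝ) * u * u ^ (α - 1) := by
      rw [← Real.rpow_add_one hu.ne', ← Real.rpow_add hu]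
      congr 1
      ring
    rw [he, hp, mul_div_assoc u, Real.mul_rpow hu.le (by positivity), hK]
    ring
  rw [setLIntegral_congr_fun measurableSet_Ioi hintegrand,
    ← ofReal_integral_eq_lintegral_ofReal, integral_const_mul, hint, hconst]
  -- A non-integrable function has Bochner integral 0, so the positive value in `hint` proves
  -- integrability.
  · refine Integrable.const_mul (.of_integral_ne_zero ?_) K
    rw [hint]
    positivity
  · refine ae_restrict_of_forall_mem measurableSet_Ioi fun u hu => ?_
    have hu : 0 < u := hu
    simp only [Pi.zero_apply]
    positivity

/-- Substituting `v = u (1 - z) / z`. -/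
theorem lintegral_Ioi_comp_div_add {u : ℝ} (hu : 0 < u) (g : ℝ → ENNReal) (f : ℝ → ENNReal) :
    ∫⁻ v in Ioi (0 : ℝ), g v * f (u / (u + v)) =
      ∫⁻ z in Ioo (0 : ℝ) 1, ENNReal.ofReal (u / z ^ 2) * g (u * (1 - z) / z) * f z := by
  have himg : (fun z : ℝ => u * (1 - z) / z) '' Ioo 0 1 = Ioi 0 := by
    ext v
    constructor
    · rintro ⟨z, hz, rfl⟩
      have := hz.1
      have := sub_pos.2 hz.2
      exact mem_Ioi.2 (by positivity)
    · intro hv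
      have hv : 0 < v := hv
      refine ⟨u / (u + v), ⟨by positivity, (div_lt_one (by positivity)).2 (by linarith)⟩, ?_⟩
      simp only
      field_simp
      ring
  have hinv : ∀ z ∈ Ioo (0 : ℝ) 1, u / (u + u * (1 - z) / z) = z := fun z hz => by
    have := hz.1
    have h : u + u * (1 - z) / z = u / z := by field_simp; ring
    rw [h]
    field_simp
  rw [← himg, lintegral_image_eq_lintegral_abs_deriv_mul (f' := fun z => -(u / z ^ 2))
    measurableSet_Ioo ?_ ?_]
  · refine setLIntegral_congr_fun measurableSet_Ioo fun z hz => ?_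
    have := hz.1
    rw [hinv z hz, abs_neg, abs_of_pos (by positivity), mul_assoc]
  · intro z hz
    have hz0 := hz.1.ne'
    have h := (((hasDerivAt_id z).const_sub 1).const_mul u).div (hasDerivAt_id z) hz0
    refine (h.congr_deriv ?_).hasDerivWithinAt
    simp only [id]
    field_simp
    ring
  · intro a ha b hb hab
    rw [← hinv a ha, ← hinv b hb]
    simp only at hab
    rw [hab]

theorem lintegral_gammaMeasure (a r : ℝ) {f : ℝ → ENNReal} (hf : Measurable f) :
    ∫⁻ x, f x ∂(gammaMeasure a r) = ∫⁻ x in Ioi (0 : ℝ), gammaPDF a r x * f x := by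
  have hm : Measurable (gammaPDF a r) := (measurable_gammaPDFReal a r).ennreal_ofReal
  rw [gammaMeasure, lintegral_withDensity_eq_lintegral_mul _ hm hf,
    setLIntegral_congr Ioi_ae_eq_Ici, ← lintegral_indicator measurableSet_Ici]
  congr with x
  by_cases hx : 0 ≤ x
  · simp [hx]
  · simp [hx, gammaPDF_of_neg (not_le.1 hx)]

/-- The law of `u / (u + v)` for independent Gamma variables `u` and `v`. -/
theorem hasLaw_div_add_gammaLaw {α γ : ℝ} (hα : 0 < α) (hγ : 0 < γ)
    {Ω : Type*} [MeasurableSpace Ω] {P : Measure Ω} [IsProbabilityMeasure P] {u v : Ω → ℝ}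
    (hu : HasLaw u (gammaLaw (1 / 2) 2) P) (hv : HasLaw v (gammaLaw α (2 * γ)) P)
    (huv : IndepFun u v P) :
    HasLaw (fun ω => u ω / (u ω + v ω))
      (volume.withDensity fun z => ENNReal.ofReal (specDensity α γ z)) P := by
  have hum := hu.aemeasurable
  have hvm := hv.aemeasurable
  have := isProbabilityMeasure_gammaMeasure (a := 1 / 2) (r := 2⁻¹) (by norm_num) (by norm_num)
  have := isProbabilityMeasure_gammaMeasure (a := α) (r := (2 * γ)⁻¹) hα (by positivity)
  refine ⟨by fun_prop, Measure.ext fun s hs => ?_⟩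
  have hq : Measurable fun p : ℝ × ℝ => p.1 / (p.1 + p.2) := by fun_prop
  have hmap : P.map (fun ω => u ω / (u ω + v ω)) =
      ((gammaMeasure (1 / 2) 2⁻¹).prod (gammaMeasure α (2 * γ)⁻¹)).map
        (fun p : ℝ × ℝ => p.1 / (p.1 + p.2)) := by
    have h := (indepFun_iff_map_prod_eq_prod_map_map hum hvm).1 huv
    rw [hu.map_eq, hv.map_eq] at h
    rw [gammaLaw, gammaLaw] at h
    rw [← h, AEMeasurable.map_map_of_aemeasurable hq.aemeasurable (hum.prodMk hvm)]
    rfl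
  set f : ℝ → ENNReal := s.indicator 1 with hf
  have hfm : Measurable f := measurable_one.indicator hs
  have hg1 : Measurable (gammaPDF (1 / 2) 2⁻¹) :=
    (measurable_gammaPDFReal _ _).ennreal_ofReal
  have hg2 : Measurable (gammaPDF α (2 * γ)⁻¹) := (measurable_gammaPDFReal _ _).ennreal_ofReal
  have hin : ∀ x ∈ Ioi (0 : ℝ), gammaPDF (1 / 2) 2⁻¹ x *
      ∫⁻ y, f (x / (x + y)) ∂(gammaMeasure α (2 * γ)⁻¹) =
      ∫⁻ z in Ioo (0 : ℝ) 1, gammaPDF (1 / 2) 2⁻¹ x * (ENNReal.ofReal (x / z ^ 2) *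
        gammaPDF α (2 * γ)⁻¹ (x * (1 - z) / z)) * f z := fun x hx => by
    rw [lintegral_gammaMeasure _ _ (by fun_prop), lintegral_Ioi_comp_div_add hx,
      ← lintegral_const_mul _ (by fun_prop)]
    simp only [mul_assoc]
  calc P.map (fun ω => u ω / (u ω + v ω)) s
      = ∫⁻ z, f z ∂(P.map (fun ω => u ω / (u ω + v ω))) := (lintegral_indicator_one hs).symm
    _ = ∫⁻ x, ∫⁻ y, f (x / (x + y)) ∂(gammaMeasure α (2 * γ)⁻¹)
          ∂(gammaMeasure (1 / 2) 2⁻¹) := by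
        rw [hmap, lintegral_map hfm hq, lintegral_prod _ (by fun_prop)]
    _ = ∫⁻ x in Ioi (0 : ℝ), ∫⁻ z in Ioo (0 : ℝ) 1, gammaPDF (1 / 2) 2⁻¹ x *
          (ENNReal.ofReal (x / z ^ 2) * gammaPDF α (2 * γ)⁻¹ (x * (1 - z) / z)) * f z := by
        rw [lintegral_gammaMeasure _ _
          (Measurable.lintegral_prod_right' (f := fun p : ℝ × ℝ => f (p.1 / (p.1 + p.2)))
            (by fun_prop))]
        exact setLIntegral_congr_fun measurableSet_Ioi hin
    _ = ∫⁻ z in Ioo (0 : ℝ) 1, ENNReal.ofReal (specDensity α γ z) * f z := by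
        rw [lintegral_lintegral_swap (by fun_prop)]
        refine setLIntegral_congr_fun measurableSet_Ioo fun z hz => ?_
        rw [lintegral_mul_const _ (by fun_prop), lintegral_gammaPDF_mul_gammaPDF hα hγ hz]
    _ = ∫⁻ z, ENNReal.ofReal (specDensity α γ z) * f z := by
        rw [← lintegral_indicator measurableSet_Ioo]
        congr with z
        by_cases hz : z ∈ Ioo (0 : ℝ) 1
        · rw [indicator_of_mem hz]
        · rw [indicator_of_notMem hz, specDensity_of_notMem hγ hz, ENNReal.ofReal_zero, zero_mul]
    _ = _ := by
        rw [withDensity_apply _ hs, ← lintegral_indicator hs]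
        congr with z
        by_cases hz : z ∈ s <;> simp [hf, hz]

/-! ### Positivity of the shape and the scale. -/

theorem specWeight_pos {d : ℕ} {σ : Fin d → ℝ} (k : ℕ) {l : Fin d} (h : 0 < σ l) :
    0 < specWeight σ k l := by
  unfold specWeight
  positivity

theorem specWeight_nonneg {d : ℕ} (σ : Fin d → ℝ) (k : ℕ) (l : Fin d) :
    0 ≤ specWeight σ k l :=
  sq_nonneg _

theorem sum_specWeight_pos {d : ℕ} {σ : Fin d → ℝ} (k : ℕ) {i : Fin d}
    (hne : ∃ l, l ≠ i ∧ 0 < σ l) : 0 < ∑ l ∈ Finset.univ.erase i, specWeight σ k l := by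
  obtain ⟨l, hl, hpos⟩ := hne
  exact Finset.sum_pos' (fun j _ => specWeight_nonneg σ k j)
    ⟨l, by simp [hl], specWeight_pos k hpos⟩

theorem sum_specWeight_sq_pos {d : ℕ} {σ : Fin d → ℝ} (k : ℕ) {i : Fin d}
    (hne : ∃ l, l ≠ i ∧ 0 < σ l) : 0 < ∑ l ∈ Finset.univ.erase i, specWeight σ k l ^ 2 := by
  obtain ⟨l, hl, hpos⟩ := hne
  exact Finset.sum_pos' (fun j _ => sq_nonneg _)
    ⟨l, by simp [hl], pow_pos (specWeight_pos k hpos) 2⟩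

theorem specShape_pos {d : ℕ} {σ : Fin d → ℝ} (k : ℕ) {i : Fin d}
    (hne : ∃ l, l ≠ i ∧ 0 < σ l) : 0 < specShape σ k i := by
  have := sum_specWeight_pos k hne
  have := sum_specWeight_sq_pos k hne
  unfold specShape
  positivity

theorem specScale_pos {d : ℕ} {σ : Fin d → ℝ} (k : ℕ) {i : Fin d} (hi : 0 < σ i)
    (hne : ∃ l, l ≠ i ∧ 0 < σ l) : 0 < specScale σ k i := by
  have := specWeight_pos k hi
  have := sum_specWeight_pos k hne
  have := sum_specWeight_sq_pos k hne
  unfold specScale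
  positivity

/-! ### Moments of the density in closed form. -/

theorem pow_mul_specDensity_of_mem {α γ z : ℝ} (hγ : 0 < γ) (m : ℕ) (hz : z ∈ Ioo (0 : ℝ) 1) :
    z ^ m * specDensity α γ z = γ ^ (1 / 2 : ℝ) / beta (1 / 2) α *
      (z ^ (1 / 2 + m - 1 : ℝ) * (1 - z) ^ (α - 1) * (1 - (1 - γ) * z) ^ (-(1 / 2 + α))) := by
  rw [specDensity_of_mem hγ hz, show (1 / 2 + m - 1 : ℝ) = 1 / 2 - 1 + m by ring,
    Real.rpow_add_natCast hz.1.ne']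
  ring

theorem intervalIntegrable_pow_mul_specDensity {α γ : ℝ} (hα : 0 < α) (hγ : 0 < γ) (m : ℕ) :
    IntervalIntegrable (fun z => z ^ m * specDensity α γ z) volume 0 1 := by
  rw [intervalIntegrable_iff_integrableOn_Ioo_of_le zero_le_one]
  exact IntegrableOn.congr_fun ((integrableOn_rpow_mul_one_sub_rpow_mul (p := 1 / 2 + m)
    (by positivity) hα (1 / 2 + α) (sub_lt_self 1 hγ)).const_mul _)
    (fun z hz => (pow_mul_specDensity_of_mem hγ m hz).symm) measurableSet_Ioo

theorem integral_pow_mul_specDensity {α γ : ℝ} (hγ : 0 < γ) (m : ℕ) :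
    ∫ z in (0 : ℝ)..1, z ^ m * specDensity α γ z = γ ^ (1 / 2 : ℝ) / beta (1 / 2) α *
      ∫ z in Ioo (0 : ℝ) 1,
        z ^ (1 / 2 + m - 1 : ℝ) * (1 - z) ^ (α - 1) * (1 - (1 - γ) * z) ^ (-(1 / 2 + α)) := by
  rw [intervalIntegral.integral_of_le zero_le_one, integral_Ioc_eq_integral_Ioo,
    ← integral_const_mul]
  exact setIntegral_congr_fun measurableSet_Ioo fun z hz => pow_mul_specDensity_of_mem hγ m hz

theorem specMean_eq {α γ : ℝ} (hα : 0 < α) (hγ : 0 < γ) :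
    specMean α γ = γ ^ (1 / 2 : ℝ)
        * (Real.Gamma (3 / 2) * Real.Gamma (1 / 2 + α)
          / (Real.Gamma (1 / 2) * Real.Gamma (3 / 2 + α)))
        * hyp2F1 (3 / 2) (1 / 2 + α) (3 / 2 + α) (1 - γ) := by
  have h := integral_pow_mul_specDensity (α := α) hγ 1
  simp only [pow_one, Nat.cast_one, show (1 / 2 + 1 : ℝ) = 3 / 2 by norm_num] at h
  rw [specMean, h, integral_eq_beta_mul_hyp2F1 (by norm_num) hα (by positivity)
    (sub_lt_self 1 hγ), beta, beta]
  have := (Real.Gamma_pos_of_pos hα).ne'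
  have := (Real.Gamma_pos_of_pos (add_pos one_half_pos hα)).ne'
  field_simp

theorem integral_sq_mul_specDensity {α γ : ℝ} (hα : 0 < α) (hγ : 0 < γ) :
    ∫ z in (0 : ℝ)..1, z ^ 2 * specDensity α γ z =
      1 / √Real.pi * γ ^ (1 / 2 : ℝ) * (Real.Gamma (1 / 2 + α) / Real.Gamma α) *
        (2 / 5 * hyp2F1 (5 / 2) (1 - α) (7 / 2) 1
            * hyp2F1 (5 / 2) (3 / 2 + α) (5 / 2 + α) (1 - γ)
          + 2 / 7 * (γ - 1) * hyp2F1 (7 / 2) (1 - α) (9 / 2) 1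
            * hyp2F1 (7 / 2) (3 / 2 + α) (7 / 2 + α) (1 - γ)) := by
  have hx : 1 - γ < 1 := sub_lt_self 1 hγ
  have h5 := hyp2F1_at_one (s := 5 / 2) (by norm_num) hα
  have h7 := hyp2F1_at_one (s := 7 / 2) (by norm_num) hα
  -- Brings 1/s and s + 1 to the displayed constants 2/5, 7/2 and 2/7, 9/2.
  norm_num at h5 h7
  rw [integral_pow_mul_specDensity hγ 2, h5, mul_right_comm (2 / 7 : ℝ), h7,
    ← integral_eq_beta_mul_hyp2F1 (by norm_num) hα (by positivity) hx,
    mul_right_comm (beta (7 / 2) α),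
    ← integral_eq_beta_mul_hyp2F1 (by norm_num) hα (by positivity) hx, ← integral_mul_const,
    ← integral_add (integrableOn_rpow_mul_one_sub_rpow_mul (by norm_num) hα _ hx)
      ((integrableOn_rpow_mul_one_sub_rpow_mul (by norm_num) hα _ hx).mul_const _)]
  congr 1
  · have := (Real.Gamma_pos_of_pos hα).ne'
    have := (Real.Gamma_pos_of_pos (add_pos one_half_pos hα)).ne'
    rw [beta, Real.Gamma_one_half_eq]
    field_simp
  · refine setIntegral_congr_fun measurableSet_Ioo fun z hz => ?_
    have hD : 0 < 1 - (1 - γ) * z := by nlinarith [mul_pos hγ hz.1, hz.2]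
    -- One power of D is split off. With D = 1 + (γ - 1)z, its two terms give the Euler integrals
    -- with p = 5/2 and p = 7/2.
    have e1 : (1 - (1 - γ) * z) ^ (-(1 / 2 + α)) =
        (1 - (1 - γ) * z) ^ (-(3 / 2 + α)) * (1 - (1 - γ) * z) := by
      rw [← Real.rpow_add_one hD.ne']
      congr 1
      ring
    have e2 : z ^ (7 / 2 - 1 : ℝ) = z ^ (5 / 2 - 1 : ℝ) * z := by
      rw [← Real.rpow_add_one hz.1.ne']
      norm_num
    have e3 : (1 / 2 + (2 : ℕ) - 1 : ℝ) = 5 / 2 - 1 := by norm_num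
    simp only [e1, e2, e3]
    ring

/-! ### Moments of the random variable and the conclusion. -/

/-- Moments of a variable with density `specDensity`. -/
theorem integral_pow_of_hasLaw {α γ : ℝ} (hα : 0 < α) (hγ : 0 < γ)
    {Ω : Type*} [MeasurableSpace Ω] {P : Measure Ω} {x : Ω → ℝ}
    (hx : HasLaw x (volume.withDensity fun z => ENNReal.ofReal (specDensity α γ z)) P) (m : ℕ) :
    ∫ ω, x ω ^ m ∂P = ∫ z in (0 : ℝ)..1, z ^ m * specDensity α γ z := by
  have h := hx.integral_comp (f := fun z => z ^ m)
    (Measurable.aestronglyMeasurable (by fun_prop))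
  simp only [Function.comp_def] at h
  rw [h, integral_withDensity_eq_integral_toReal_smul (measurable_specDensity α γ).ennreal_ofReal
    (by simp), intervalIntegral.integral_of_le zero_le_one, integral_Ioc_eq_integral_Ioo,
    ← integral_indicator measurableSet_Ioo]
  congr with z
  by_cases hz : z ∈ Ioo (0 : ℝ) 1
  · rw [indicator_of_mem hz, ENNReal.toReal_ofReal (specDensity_nonneg hα hγ z), smul_eq_mul,
      mul_comm]
  · simp [indicator_of_notMem hz, specDensity_of_notMem hγ hz]

/-- The law charges only (0,1), so x is almost surely bounded by 1. -/
theorem memLp_two_of_hasLaw {α γ : ℝ} (hγ : 0 < γ)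
    {Ω : Type*} [MeasurableSpace Ω] {P : Measure Ω} [IsProbabilityMeasure P] {x : Ω → ℝ}
    (hx : HasLaw x (volume.withDensity fun z => ENNReal.ofReal (specDensity α γ z)) P) :
    MemLp x 2 P := by
  refine MemLp.of_bound hx.aemeasurable.aestronglyMeasurable 1 ?_
  rw [hx.ae_iff (p := fun z => ‖z‖ ≤ 1) (by
    exact measurableSet_setOfPred.1 (measurableSet_le measurable_norm measurable_const)),
    ae_withDensity_iff (measurable_specDensity α γ).ennreal_ofReal]
  refine Filter.Eventually.of_forall fun z hz => ?_
  have hmem : z ∈ Ioo (0 : ℝ) 1 := by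
    by_contra h
    simp [specDensity_of_notMem hγ h] at hz
  rw [Real.norm_eq_abs, abs_of_pos hmem.1]
  exact hmem.2.le

theorem abs_one_div_sqrt_pi_sub_le : |1 / √Real.pi - 0.56419| ≤ 0.000005 := by
  have h1 := Real.pi_gt_d6
  have h2 := Real.pi_lt_d6
  have hs : 0 < √Real.pi := Real.sqrt_pos.2 Real.pi_pos
  rw [abs_le]
  constructor
  -- The endpoints are 0.56419 ∓ 0.000005. Inverted and squared, they become bounds on π that six
  -- decimals settle.
  · have : √Real.pi ≤ 1 / 0.564185 := Real.sqrt_le_iff.2 ⟨by norm_num, by norm_num; linarith⟩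
    have := one_div_le_one_div_of_le hs this
    norm_num at this ⊢
    linarith
  · have : 1 / 0.564195 ≤ √Real.pi := Real.le_sqrt_of_sq_le (by norm_num; linarith)
    have := one_div_le_one_div_of_le (by norm_num) this
    norm_num at this ⊢
    linarith

theorem proposition3 {d : ℕ} (k : ℕ) (σ : Fin d → ℝ) (hσ : ∀ l, 0 ≤ σ l)
    (i : Fin d) (hi : 0 < σ i) (hne : ∃ l, l ≠ i ∧ 0 < σ l)
    (α γ lam : ℝ) (hα : α = specShape σ k i) (hγ : γ = specScale σ k i)
    (hlam : lam = specMean α γ)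
    {Ω : Type*} [MeasurableSpace Ω] (P : Measure Ω) [IsProbabilityMeasure P] (u v : Ω → ℝ)
    (hu : HasLaw u (gammaLaw (1 / 2) 2) P) (hv : HasLaw v (gammaLaw α (2 * γ)) P)
    (huv : IndepFun u v P) (x : Ω → ℝ) (hx : ∀ ω, x ω = u ω / (u ω + v ω)) :
    -- `x•` is the density of `x = u / (u + v)`, and it has first and second moments
    HasLaw x (volume.withDensity fun z => ENNReal.ofReal (specDensity α γ z)) P ∧
    IntervalIntegrable (fun z => z * specDensity α γ z) volume 0 1 ∧
    IntervalIntegrable (fun z => z ^ 2 * specDensity α γ z) volume 0 1 ∧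
    -- `ω² = E(z²) - (E z)² = ∫₀¹ z² x•(z) dz - λ²`
    variance x P = (∫ ω, x ω ^ 2 ∂P) - (∫ ω, x ω ∂P) ^ 2 ∧
    (∫ ω, x ω ^ 2 ∂P) - (∫ ω, x ω ∂P) ^ 2 =
      (∫ z in (0 : ℝ)..1, z ^ 2 * specDensity α γ z) - lam ^ 2 ∧
    -- the closed form of the variance
    (∫ z in (0 : ℝ)..1, z ^ 2 * specDensity α γ z) - lam ^ 2 =
      1 / √Real.pi * γ ^ (1 / 2 : ℝ) * (Real.Gamma (1 / 2 + α) / Real.Gamma α) *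
        (2 / 5 * hyp2F1 (5 / 2) (1 - α) (7 / 2) 1
            * hyp2F1 (5 / 2) (3 / 2 + α) (5 / 2 + α) (1 - γ)
          + 2 / 7 * (γ - 1) * hyp2F1 (7 / 2) (1 - α) (9 / 2) 1
            * hyp2F1 (7 / 2) (3 / 2 + α) (7 / 2 + α) (1 - γ)) - lam ^ 2 ∧
    -- the closed form of `λ` that enters it
    lam = γ ^ (1 / 2 : ℝ)
        * (Real.Gamma (3 / 2) * Real.Gamma (1 / 2 + α)
          / (Real.Gamma (1 / 2) * Real.Gamma (3 / 2 + α)))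
        * hyp2F1 (3 / 2) (1 / 2 + α) (3 / 2 + α) (1 - γ) ∧
    -- the constants are `0.56419`, `0.4`, `0.28571`, rounded to five decimals
    |1 / √Real.pi - 0.56419| ≤ 0.000005 ∧ (2 / 5 : ℝ) = 0.4 ∧ |(2 / 7 : ℝ) - 0.28571| ≤ 0.000005 := by
  have hα0 : 0 < α := hα ▸ specShape_pos k hne
  have hγ0 : 0 < γ := hγ ▸ specScale_pos k hi hne
  have hlaw : HasLaw x (volume.withDensity fun z => ENNReal.ofReal (specDensity α γ z)) P := by
    rw [show x = fun ω => u ω / (u ω + v ω) from funext hx]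
    exact hasLaw_div_add_gammaLaw hα0 hγ0 hu hv huv
  have hmean : ∫ ω, x ω ∂P = lam := by
    simpa [hlam, specMean] using integral_pow_of_hasLaw hα0 hγ0 hlaw 1
  refine ⟨hlaw, by simpa using intervalIntegrable_pow_mul_specDensity hα0 hγ0 1,
    intervalIntegrable_pow_mul_specDensity hα0 hγ0 2,
    variance_eq_sub (memLp_two_of_hasLaw hγ0 hlaw), ?_, ?_, hlam.trans (specMean_eq hα0 hγ0),
    abs_one_div_sqrt_pi_sub_le, by norm_num, by norm_num [abs_le]⟩
  · rw [integral_pow_of_hasLaw hα0 hγ0 hlaw 2, hmean]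
  · rw [integral_sq_mul_specDensity hα0 hγ0]
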